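/- Let $(R,\mathfrak m,K)$ be a Noetherian local ring of Krull dimension $d$, and let $\underline x = x_1,\dots,x_d$ and $\underline y = y_1,\dots,y_d$ be two systems of parameters for $R$. For an $R$-module $M$ let $h_j(\underline x;M)\in\mathbb N\cup\{\infty\}$ be the length of the Koszul homology module $H_j(\underline x;M)$, and put $\sigma_i(\underline x;M)=\sum_{j=i}^{d}h_j(\underline x;M)$. (1) There exist positive constants $C, C'$, independent of $i$ and $M$, such that for every $i\ge 1$ and every $R$-module $M$, $$\sigma_i(\underline x;M)\le C\,\sigma_i(\underline y;M)\quad\text{and}\quad \sigma_i(\underline y;M)\le C'\,\sigma_i(\underline x;M).$$ (2) Write $\nu(M)=\dim_K(K\otimes_R M)$. For every sequence $\{M_n\}_n$ of finitely generated $R$-modules, $h_i(\underline x;M_n)=\mathrm{o}(\nu(M_n))$ for all $i\ge 1$ if and only if $h_i(\underline y;M_n)=\mathrm{o}(\nu(M_n))$ for all $i\ge 1$. Here $h_i(\underline x;M_n)=\mathrm{o}(\nu(M_n))$ means that for every real $\varepsilon>0$ one has $h_i(\underline x;M_n)\le\varepsilon\,\nu(M_n)$ for all sufficiently large $n$. (3)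 Call a sequence $\{M_n\}_n$ of nonzero finitely generated $R$-modules lim Cohen-Macaulay if $h_i(\underline z;M_n)=\mathrm{o}(\nu(M_n))$ for all $i\ge1$, for some system of parameters $\underline z$ of $R$. Then $\{M_n\}_n$ is lim Cohen-Macaulay if and only if $h_i(\underline x;M_n)=\mathrm{o}(\nu(M_n))$ for all $i\ge 1$; hence the property does not depend on the choice of the system of parameters. -/

import Mathlib

open CategoryTheory Filter TensorProduct
open scoped NNReal ENNReal

universe u v

noncomputable section

/-- `x₁, …, x_d` is a system of parameters of the local ring `R`: `d` is the Krull dimension of `R`,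
and the ideal `(x₁, …, x_d)` is primary to the maximal ideal (its radical is the maximal ideal). -/
def IsSystemOfParameters {R : Type u} [CommRing R] [IsLocalRing R] {d : ℕ} (x : Fin d → R) : Prop :=
  ringKrullDim R = d ∧ (Ideal.span (Set.range x)).radical = IsLocalRing.maximalIdeal R

section Koszul

variable {R : Type u} [CommRing R] {d : ℕ} (x : Fin d → R) (M : Type v) [AddCommGroup M] [Module R M]

/-- The differential of the Koszul complex `K(x; M)`. For the free module `F = R^d` the canonical
isomorphism `⋀ⁱ F ⊗ M ≅ Hom(⋀ⁱ F*, M)` describes a chain of degree `i` as an alternating `i`-linear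
map `f` on `F* = R^d` with values in `M`; its value at `(e_{j₁}, …, e_{jᵢ})` is the coefficient in
`M` of the basis element `e_{j₁} ∧ ⋯ ∧ e_{jᵢ}`. The usual differential
`e_{j₀} ∧ ⋯ ∧ e_{jᵢ} ↦ ∑ₖ (-1)ᵏ x_{jₖ} e_{j₀} ∧ ⋯ (omit e_{jₖ}) ⋯ ∧ e_{jᵢ}`, that is, contraction
with `x`, becomes `(∂ f)(v₁, …, vᵢ) = f(x, v₁, …, vᵢ)`; see `koszulD_apply_basis`. -/
def koszulD (i : ℕ) :
    ((Fin d → R) [⋀^Fin (i + 1)]→ₗ[R] M) →ₗ[R] ((Fin d → R) [⋀^Fin i]→ₗ[R] M) where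
  toFun f := f.curryLeft x
  map_add' _ _ := rfl
  map_smul' _ _ := rfl

/-- The Koszul differential in coordinates: the coefficient of `∂ f` at `e_{J 1} ∧ ⋯ ∧ e_{J i}` is
the sum over `j` of `x_j` times the coefficient of `f` at `e_j ∧ e_{J 1} ∧ ⋯ ∧ e_{J i}`. -/
theorem koszulD_apply_basis (i : ℕ) (f : (Fin d → R) [⋀^Fin (i + 1)]→ₗ[R] M) (J : Fin i → Fin d) :
    koszulD x M i f (fun k => Pi.single (J k) 1) =
      ∑ j, x j • f (fun k => Pi.single ((Fin.cons j J : Fin (i + 1) → Fin d) k) 1) := by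
  have hx : x = ∑ j, x j • (Pi.single j 1 : Fin d → R) := by
    ext k
    simp [Finset.sum_apply, Pi.single_apply]
  let L : (Fin d → R) →ₗ[R] M :=
    { toFun := fun v => f.curryLeft v (fun k => Pi.single (J k) 1)
      map_add' := fun v w => by rw [map_add, AlternatingMap.add_apply]
      map_smul' := fun r v => by rw [map_smul, AlternatingMap.smul_apply, RingHom.id_apply] }
  change L x = _
  conv_lhs => rw [hx]
  rw [map_sum]
  refine Finset.sum_congr rfl fun j _ => ?_
  rw [map_smul]
  congr 1
  change f _ = f _
  congr 1
  funext k
  cases k using Fin.cases <;> rfl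

theorem koszulD_comp_koszulD (i : ℕ) : koszulD x M i ∘ₗ koszulD x M (i + 1) = 0 := by
  refine LinearMap.ext fun f => ?_
  exact f.curryLeft_same x

/-- The Koszul complex `K(x; M)`, with the complex `0 → M → 0` in degree `0` when `d = 0`. -/
def koszulComplex : ChainComplex (ModuleCat.{max u v} R) ℕ :=
  ChainComplex.of (fun i => ModuleCat.of R ((Fin d → R) [⋀^Fin i]→ₗ[R] M))
    (fun i => ModuleCat.ofHom (koszulD x M i))
    (fun i => by rw [← ModuleCat.ofHom_comp, koszulD_comp_koszulD]; rfl)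

/-- `h_i(x; M)`, the length of the Koszul homology module `H_i(x; M)` (possibly `⊤`). -/
def koszulLength (i : ℕ) : ℕ∞ :=
  Module.length R ((koszulComplex x M).homology i)

/-- `σ_i(x; M) = h_i(x; M) + ⋯ + h_d(x; M)`. -/
def koszulSigma (i : ℕ) : ℕ∞ :=
  ∑ j ∈ Finset.Icc i d, koszulLength x M j

end Koszul

section LimCohenMacaulay

variable {R : Type u} [CommRing R] [IsLocalRing R]

/-- `ν(M) = dim_K (K ⊗ M)`, the least number of generators of a finitely generated module `M`. -/
def minGenerators (R : Type u) [CommRing R] [IsLocalRing R] (M : Type v) [AddCommGroup M]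
    [Module R M] : ℕ :=
  Module.finrank (IsLocalRing.ResidueField R) (IsLocalRing.ResidueField R ⊗[R] M)

/-- `h_i(x; M_n) = o(ν(M_n))` as `n → ∞`, for every `i ≥ 1`. -/
def KoszulLittleO {d : ℕ} (x : Fin d → R) (M : ℕ → Type v) [∀ n, AddCommGroup (M n)]
    [∀ n, Module R (M n)] : Prop :=
  ∀ i : ℕ, 1 ≤ i → ∀ ε : ℝ≥0, 0 < ε → ∀ᶠ n in atTop,
    (koszulLength x (M n) i : ℝ≥0∞) ≤ (ε : ℝ≥0∞) * (minGenerators R (M n) : ℝ≥0∞)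

/-- A sequence of nonzero finitely generated modules is lim Cohen-Macaulay if
`h_i(x; M_n) = o(ν(M_n))` for every `i ≥ 1`, for some system of parameters `x` of `R`. -/
def IsLimCohenMacaulay (R : Type u) [CommRing R] [IsLocalRing R] (M : ℕ → Type v)
    [∀ n, AddCommGroup (M n)] [∀ n, Module R (M n)] : Prop :=
  (∀ n, Module.Finite R (M n) ∧ Nontrivial (M n)) ∧
    ∃ (d : ℕ) (x : Fin d → R), IsSystemOfParameters x ∧ KoszulLittleO x M

end LimCohenMacaulay

end

/-! Adjoining an element `a` to a sequence replaces the Koszul complex by the mapping cone of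
multiplication by `a`. The cone sequence gives `h_j(a, x) ≤ h_j(x) + h_{j-1}(x)`
(`homologyLength_coneD_le`), with equality if `a ∈ (x)`, since `a` then kills the homology of `x`
(`homologyLength_coneD_eq`, `exists_contraction_eq_smul`).

Suppose first that all `x_k` lie in `(y)`, and compare both sequences with their concatenation.
Building it from `y` uses equality `d` times and gives `σ_i(y) ≤ σ_{i+d}(x, y)`; building it from
`x` uses the inequality `d` times and gives `σ_{i+d}(x, y) ≤ 2^d σ_i(x)`. This is
`tailLength_le_of_mem_span`.

For two systems of parameters only powers `x_k^(t+1)` lie in `(y)`. The cones of `a`, `ab` and `b`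
form an exact triangle, so `h_j` is subadditive in each factor of an entry, and passing to these
powers costs at most `(t+1)^d` (`contractionLength_pow_le`). Hence `C = 2^d (t+1)^d`, independent of
`i` and `M`. The asymptotic statements follow because `σ_i` is a finite sum bounding `h_i`. -/

section HomologyLength

variable {R : Type*} [CommRing R]

/-- The length of the subquotient `Z / (B ∩ Z)`. -/
noncomputable def subquotientLength {P : Type*} [AddCommGroup P] [Module R P]
    (Z B : Submodule R P) : ℕ∞ :=
  Module.length R (Z ⧸ B.submoduleOf Z)

/-! ### Exact sequences of subquotients. -/

section Subquotient

variable {P P' P'' : Type*} [AddCommGroup P] [Module R P] [AddCommGroup P'] [Module R P']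
  [AddCommGroup P''] [Module R P'']

/-- The map of subquotients induced by a linear map. -/
def subquotientMap {Z B : Submodule R P} {Z' B' : Submodule R P'} (α : P →ₗ[R] P')
    (hZ : ∀ z ∈ Z, α z ∈ Z') (hB : ∀ b ∈ B, α b ∈ B') :
    (Z ⧸ B.submoduleOf Z) →ₗ[R] (Z' ⧸ B'.submoduleOf Z') :=
  Submodule.mapQ _ _ (α.restrict hZ) fun _ hz => hB _ hz

theorem subquotientMap_mk {Z B : Submodule R P} {Z' B' : Submodule R P'} (α : P →ₗ[R] P')
    (hZ : ∀ z ∈ Z, α z ∈ Z') (hB : ∀ b ∈ B, α b ∈ B') (z : Z) :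
    subquotientMap α hZ hB (Submodule.Quotient.mk z) =
      Submodule.Quotient.mk ⟨α z, hZ _ z.2⟩ := rfl

theorem subquotient_mk_eq_zero {Z B : Submodule R P} (z : Z) :
    (Submodule.Quotient.mk z : Z ⧸ B.submoduleOf Z) = 0 ↔ (z : P) ∈ B := by
  rw [Submodule.Quotient.mk_eq_zero]; rfl

theorem length_le_add_of_exact {A B C : Type*} [AddCommGroup A] [Module R A] [AddCommGroup B]
    [Module R B] [AddCommGroup C] [Module R C] (f : A →ₗ[R] B) (g : B →ₗ[R] C)
    (h : Function.Exact f g) :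
    Module.length R B ≤ Module.length R A + Module.length R C := by
  have key := Module.length_eq_add_of_exact (LinearMap.range f).subtype g.rangeRestrict
    (Submodule.subtype_injective _) g.surjective_rangeRestrict (by
      rw [LinearMap.exact_iff, Submodule.range_subtype, LinearMap.ker_rangeRestrict]
      exact LinearMap.exact_iff.1 h)
  rw [key]
  exact add_le_add (Module.length_le_of_surjective f.rangeRestrict f.surjective_rangeRestrict)
    (Module.length_le_of_injective _ (Submodule.subtype_injective (LinearMap.range g)))

/-- The denominators are `B ∩ Z`, so `B ≤ Z` is not required, and the cone estimates below never
need the differentials to compose to zero. -/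
theorem subquotientMap_exact {Z B : Submodule R P} {Z' B' : Submodule R P'}
    {Z'' B'' : Submodule R P''} (α : P' →ₗ[R] P) (β : P →ₗ[R] P'')
    (hZα : ∀ z ∈ Z', α z ∈ Z) (hBα : ∀ b ∈ B', α b ∈ B)
    (hZβ : ∀ z ∈ Z, β z ∈ Z'') (hBβ : ∀ b ∈ B, β b ∈ B'')
    (hcomp : ∀ z ∈ Z', β (α z) ∈ B'')
    (hex : ∀ z ∈ Z, β z ∈ B'' → ∃ z' ∈ Z', z - α z' ∈ B) :
    Function.Exact (subquotientMap (B := B') (B' := B) α hZα hBα)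
      (subquotientMap (B' := B'') β hZβ hBβ) := by
  intro q
  obtain ⟨z, rfl⟩ := Submodule.Quotient.mk_surjective _ q
  rw [subquotientMap_mk, subquotient_mk_eq_zero]
  constructor
  · intro h
    obtain ⟨z', hz', hb⟩ := hex z z.2 h
    refine ⟨Submodule.Quotient.mk ⟨z', hz'⟩, ?_⟩
    rw [subquotientMap_mk, eq_comm, ← sub_eq_zero, ← Submodule.Quotient.mk_sub,
      subquotient_mk_eq_zero]
    exact hb
  · rintro ⟨q', hq'⟩
    obtain ⟨z', rfl⟩ := Submodule.Quotient.mk_surjective _ q'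
    rw [subquotientMap_mk, eq_comm, ← sub_eq_zero, ← Submodule.Quotient.mk_sub,
      subquotient_mk_eq_zero] at hq'
    have h1 := hBβ _ hq'
    have h2 := B''.add_mem h1 (hcomp z' z'.2)
    simpa using h2

theorem subquotientLength_le_add {Z B : Submodule R P} {Z' B' : Submodule R P'}
    {Z'' B'' : Submodule R P''} (α : P' →ₗ[R] P) (β : P →ₗ[R] P'')
    (hZα : ∀ z ∈ Z', α z ∈ Z) (hBα : ∀ b ∈ B', α b ∈ B)
    (hZβ : ∀ z ∈ Z, β z ∈ Z'') (hBβ : ∀ b ∈ B, β b ∈ B'')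
    (hcomp : ∀ z ∈ Z', β (α z) ∈ B'')
    (hex : ∀ z ∈ Z, β z ∈ B'' → ∃ z' ∈ Z', z - α z' ∈ B) :
    subquotientLength Z B ≤ subquotientLength Z' B' + subquotientLength Z'' B'' :=
  length_le_add_of_exact _ _ (subquotientMap_exact α β hZα hBα hZβ hBβ hcomp hex)

theorem subquotientLength_eq_add {Z B : Submodule R P} {Z' B' : Submodule R P'}
    {Z'' B'' : Submodule R P''} (α : P' →ₗ[R] P) (β : P →ₗ[R] P'')
    (hZα : ∀ z ∈ Z', α z ∈ Z) (hBα : ∀ b ∈ B', α b ∈ B)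
    (hZβ : ∀ z ∈ Z, β z ∈ Z'') (hBβ : ∀ b ∈ B, β b ∈ B'')
    (hcomp : ∀ z ∈ Z', β (α z) ∈ B'')
    (hex : ∀ z ∈ Z, β z ∈ B'' → ∃ z' ∈ Z', z - α z' ∈ B)
    (hinj : ∀ z ∈ Z', α z ∈ B → z ∈ B')
    (hsurj : ∀ z ∈ Z'', ∃ w ∈ Z, β w - z ∈ B'') :
    subquotientLength Z B = subquotientLength Z' B' + subquotientLength Z'' B'' := by
  refine Module.length_eq_add_of_exact _ _ ?_ ?_
    (subquotientMap_exact α β hZα hBα hZβ hBβ hcomp hex)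
  · rw [injective_iff_map_eq_zero]
    intro q hq
    obtain ⟨z, rfl⟩ := Submodule.Quotient.mk_surjective _ q
    rw [subquotientMap_mk, subquotient_mk_eq_zero] at hq
    exact (subquotient_mk_eq_zero z).2 (hinj z z.2 hq)
  · intro q
    obtain ⟨z, rfl⟩ := Submodule.Quotient.mk_surjective _ q
    obtain ⟨w, hw, hb⟩ := hsurj z z.2
    refine ⟨Submodule.Quotient.mk ⟨w, hw⟩, ?_⟩
    rw [subquotientMap_mk, ← sub_eq_zero, ← Submodule.Quotient.mk_sub, subquotient_mk_eq_zero]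
    exact hb

end Subquotient

/-! ### Homology of the mapping cone of multiplication by a scalar. -/

section Cone

variable {P₃ P₂ P₁ P₀ Q₃ Q₂ Q₁ : Type*}
  [AddCommGroup P₃] [Module R P₃] [AddCommGroup P₂] [Module R P₂]
  [AddCommGroup P₁] [Module R P₁] [AddCommGroup P₀] [Module R P₀]
  [AddCommGroup Q₃] [Module R Q₃] [AddCommGroup Q₂] [Module R Q₂]
  [AddCommGroup Q₁] [Module R Q₁]

/-- The length of the homology at the middle of `P₃ → P₂ → P₁`. -/
noncomputable def homologyLength (f : P₃ →ₗ[R] P₂) (g : P₂ →ₗ[R] P₁) : ℕ∞ :=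
  subquotientLength (LinearMap.ker g) (LinearMap.range f)

theorem homologyLength_congr {f : P₃ →ₗ[R] P₂} {g : P₂ →ₗ[R] P₁} {f' : Q₃ →ₗ[R] Q₂}
    {g' : Q₂ →ₗ[R] Q₁} (e₃ : P₃ ≃ₗ[R] Q₃) (e₂ : P₂ ≃ₗ[R] Q₂) (e₁ : P₁ ≃ₗ[R] Q₁)
    (hf : ∀ p, e₂ (f p) = f' (e₃ p)) (hg : ∀ p, e₁ (g p) = g' (e₂ p)) :
    homologyLength f g = homologyLength f' g' := by
  have hker : ∀ p, e₂ p ∈ LinearMap.ker g' ↔ p ∈ LinearMap.ker g := fun p => by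
    simp [← hg]
  have hran : ∀ p, e₂ p ∈ LinearMap.range f' ↔ p ∈ LinearMap.range f := fun p => by
    constructor
    · rintro ⟨q, hq⟩
      exact ⟨e₃.symm q, e₂.injective (by rw [hf, e₃.apply_symm_apply, hq])⟩
    · rintro ⟨q, rfl⟩
      exact ⟨e₃ q, (hf q).symm⟩
  have hzero : subquotientLength (R := R) (⊥ : Submodule R PUnit.{1}) ⊥ = 0 :=
    Module.length_eq_zero
  -- An isomorphism is a short exact sequence whose third term is zero.
  have key := subquotientLength_eq_add (Z := LinearMap.ker g') (B := LinearMap.range f')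
    (Z' := LinearMap.ker g) (B' := LinearMap.range f) (Z'' := (⊥ : Submodule R PUnit.{1}))
    (B'' := ⊥) e₂.toLinearMap 0 (fun p hp => (hker p).2 hp) (fun p hp => (hran p).2 hp)
    (by simp) (by simp) (by simp)
    (fun z hz _ => ⟨e₂.symm z, (hker _).1 (by simpa using hz), by simp⟩)
    (fun z _ hz => (hran z).1 hz) (fun z _ => ⟨0, by simp, Subsingleton.elim _ _⟩)
  rw [hzero, add_zero] at key
  exact key.symm

/-- The differential of the mapping cone of multiplication by `a` on a complex. -/
def coneD (a : R) (f : P₃ →ₗ[R] P₂) (g : P₂ →ₗ[R] P₁) : P₃ × P₂ →ₗ[R] P₂ × P₁ :=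
  (f.coprod (a • LinearMap.id)).prod (-(g ∘ₗ LinearMap.snd R P₃ P₂))

theorem coneD_apply (a : R) (f : P₃ →ₗ[R] P₂) (g : P₂ →ₗ[R] P₁) (p : P₃ × P₂) :
    coneD a f g p = (f p.1 + a • p.2, -g p.2) := rfl

theorem mem_ker_coneD {a : R} {f : P₃ →ₗ[R] P₂} {g : P₂ →ₗ[R] P₁} {p : P₃ × P₂} :
    p ∈ LinearMap.ker (coneD a f g) ↔ f p.1 + a • p.2 = 0 ∧ g p.2 = 0 := by
  simp [coneD_apply]

/-- The middle of the long exact sequence of the cone: the complex includes into it, and the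
quotient is the shifted complex. -/
theorem homologyLength_coneD_le (a : R) (d₃ : P₃ →ₗ[R] P₂) (d₂ : P₂ →ₗ[R] P₁)
    (d₁ : P₁ →ₗ[R] P₀) :
    homologyLength (coneD a d₃ d₂) (coneD a d₂ d₁) ≤
      homologyLength d₃ d₂ + homologyLength d₂ d₁ := by
  refine subquotientLength_le_add (LinearMap.inl R P₂ P₁) (LinearMap.snd R P₂ P₁) ?_ ?_ ?_ ?_ ?_ ?_
  · intro z hz
    exact mem_ker_coneD.2 ⟨by simpa using hz, by simp⟩
  · rintro _ ⟨w, rfl⟩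
    exact ⟨(w, 0), by simp [coneD_apply]⟩
  · intro z hz
    exact (mem_ker_coneD.1 hz).2
  · rintro _ ⟨w, rfl⟩
    exact ⟨-w.2, by simp [coneD_apply]⟩
  · intro z _
    exact ⟨0, by simp⟩
  · rintro ⟨z, w⟩ hz ⟨q, rfl : d₂ q = w⟩
    rw [mem_ker_coneD] at hz
    -- Adding the boundary of `(0, q)` clears the second coordinate.
    refine ⟨z + a • q, ?_, (0, -q), ?_⟩
    · simpa using hz.1
    · simp [coneD_apply]

/-- The connecting maps are multiplication by `a` on homology. If they vanish in both degrees, the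
long exact sequence breaks into short ones. -/
theorem homologyLength_coneD_eq (a : R) (d₃ : P₃ →ₗ[R] P₂) (d₂ : P₂ →ₗ[R] P₁)
    (d₁ : P₁ →ₗ[R] P₀)
    (h₂ : ∀ z, d₂ z = 0 → ∃ w, d₃ w = a • z) (h₁ : ∀ z, d₁ z = 0 → ∃ w, d₂ w = a • z) :
    homologyLength (coneD a d₃ d₂) (coneD a d₂ d₁) =
      homologyLength d₃ d₂ + homologyLength d₂ d₁ := by
  refine subquotientLength_eq_add (LinearMap.inl R P₂ P₁) (LinearMap.snd R P₂ P₁)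
    ?_ ?_ ?_ ?_ ?_ ?_ ?_ ?_
  · intro z hz
    exact mem_ker_coneD.2 ⟨by simpa using hz, by simp⟩
  · rintro _ ⟨w, rfl⟩
    exact ⟨(w, 0), by simp [coneD_apply]⟩
  · intro z hz
    exact (mem_ker_coneD.1 hz).2
  · rintro _ ⟨w, rfl⟩
    exact ⟨-w.2, by simp [coneD_apply]⟩
  · intro z _
    exact ⟨0, by simp⟩
  · rintro ⟨z, w⟩ hz ⟨q, rfl : d₂ q = w⟩
    rw [mem_ker_coneD] at hz
    refine ⟨z + a • q, ?_, (0, -q), ?_⟩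
    · simpa using hz.1
    · simp [coneD_apply]
  · rintro z hz ⟨⟨u, u'⟩, hu⟩
    rw [coneD_apply] at hu
    obtain ⟨w, hw⟩ := h₂ u' (by simpa using congrArg Prod.snd hu)
    refine ⟨u + w, ?_⟩
    rw [map_add, hw]
    exact congrArg Prod.fst hu
  · intro z hz
    obtain ⟨w, hw⟩ := h₁ z hz
    exact ⟨(-w, z), mem_ker_coneD.2 ⟨by simp [hw], hz⟩, by simp⟩

/-- The chain maps `(b, 1)` and `(1, a)` link the cones of `a`, `ab` and `b`, as in the octahedral
axiom; only exactness in the middle is needed. -/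
theorem homologyLength_coneD_mul_le (a b : R) (d₃ : P₃ →ₗ[R] P₂) (d₂ : P₂ →ₗ[R] P₁)
    (d₁ : P₁ →ₗ[R] P₀) :
    homologyLength (coneD (a * b) d₃ d₂) (coneD (a * b) d₂ d₁) ≤
      homologyLength (coneD a d₃ d₂) (coneD a d₂ d₁) +
        homologyLength (coneD b d₃ d₂) (coneD b d₂ d₁) := by
  refine subquotientLength_le_add
    ((b • LinearMap.id : P₂ →ₗ[R] P₂).prodMap (LinearMap.id : P₁ →ₗ[R] P₁))
    ((LinearMap.id : P₂ →ₗ[R] P₂).prodMap (a • LinearMap.id : P₁ →ₗ[R] P₁)) ?_ ?_ ?_ ?_ ?_ ?_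
  · rintro ⟨z, w⟩ hz
    rw [mem_ker_coneD] at hz ⊢
    refine ⟨?_, hz.2⟩
    have := congrArg (b • ·) hz.1
    simpa [smul_smul, mul_comm] using this
  · rintro _ ⟨⟨u, u'⟩, rfl⟩
    exact ⟨(b • u, u'), by simp [coneD_apply, smul_smul, mul_comm]⟩
  · rintro ⟨z, w⟩ hz
    rw [mem_ker_coneD] at hz ⊢
    have h1 := hz.1
    have h2 := hz.2
    simp only at h1 h2
    simp only [LinearMap.prodMap_apply, LinearMap.id_apply, LinearMap.smul_apply, map_smul, h2,
      smul_zero, smul_smul, and_true]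
    rwa [mul_comm b a]
  · rintro _ ⟨⟨u, u'⟩, rfl⟩
    exact ⟨(u, a • u'), by simp [coneD_apply, smul_smul, mul_comm]⟩
  · rintro ⟨z, w⟩ hz
    rw [mem_ker_coneD] at hz
    -- On cycles `a w = -d₂ z`, so the composite `(b z, a w)` is the boundary of `(0, z)`.
    refine ⟨(0, z), ?_⟩
    have h1 : d₂ z + a • w = 0 := hz.1
    simp [coneD_apply, neg_eq_iff_add_eq_zero, h1]
  · rintro ⟨z, w⟩ hz ⟨⟨u, u'⟩, hu⟩
    rw [mem_ker_coneD] at hz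
    simp only [coneD_apply, LinearMap.prodMap_apply, LinearMap.id_apply, LinearMap.smul_apply,
      Prod.mk.injEq] at hu
    refine ⟨(u', w), mem_ker_coneD.2 ⟨?_, hz.2⟩, (u, 0), ?_⟩
    · simp [← hu.2]
    · simp [coneD_apply, ← hu.1]

end Cone

end HomologyLength

/-! ### Koszul complexes as alternating maps, free of coordinates. -/

section Contraction

variable {R : Type*} [CommRing R] {F F' : Type*} [AddCommGroup F] [Module R F]
  [AddCommGroup F'] [Module R F'] {M : Type*} [AddCommGroup M] [Module R M]

variable (M) in
/-- Contraction of alternating maps on `F` with the vector `x`. -/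
def contraction (x : F) (n : ℕ) : (F [⋀^Fin (n + 1)]→ₗ[R] M) →ₗ[R] (F [⋀^Fin n]→ₗ[R] M) where
  toFun f := f.curryLeft x
  map_add' _ _ := rfl
  map_smul' _ _ := rfl

theorem contraction_apply (x : F) (n : ℕ) (f : F [⋀^Fin (n + 1)]→ₗ[R] M) (v : Fin n → F) :
    contraction M x n f v = f (Matrix.vecCons x v) := rfl

theorem contraction_contraction (x : F) (n : ℕ) (f : F [⋀^Fin (n + 2)]→ₗ[R] M) :
    contraction M x n (contraction M x (n + 1) f) = 0 :=
  f.curryLeft_same x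

theorem contraction_add (x y : F) (n : ℕ) (f : F [⋀^Fin (n + 1)]→ₗ[R] M) :
    contraction M (x + y) n f = contraction M x n f + contraction M y n f :=
  map_add f.curryLeft x y

theorem contraction_smul (a : R) (x : F) (n : ℕ) (f : F [⋀^Fin (n + 1)]→ₗ[R] M) :
    contraction M (a • x) n f = a • contraction M x n f :=
  map_smul f.curryLeft a x

theorem contraction_comm (x y : F) (n : ℕ) (f : F [⋀^Fin (n + 2)]→ₗ[R] M) :
    contraction M x n (contraction M y (n + 1) f) =
      -contraction M y n (contraction M x (n + 1) f) := by
  have h := contraction_contraction (x + y) n f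
  rw [contraction_add x y (n + 1), map_add, contraction_add, contraction_add,
    contraction_contraction, contraction_contraction, zero_add, add_zero] at h
  exact eq_neg_of_add_eq_zero_right h

theorem contraction_compLinearMap (φ : F' →ₗ[R] F) (x : F') (n : ℕ)
    (f : F [⋀^Fin (n + 1)]→ₗ[R] M) :
    contraction M x n (f.compLinearMap φ) = (contraction M (φ x) n f).compLinearMap φ :=
  f.curryLeft_compLinearMap φ x

/-- The exterior product of a linear form and an alternating map. -/
def formWedge (φ : F →ₗ[R] R) {n : ℕ} (k : F [⋀^Fin n]→ₗ[R] M) : F [⋀^Fin (n + 1)]→ₗ[R] M :=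
  AlternatingMap.alternatizeUncurryFin (φ.smulRight k)

theorem formWedge_apply (φ : F →ₗ[R] R) {n : ℕ} (k : F [⋀^Fin n]→ₗ[R] M) (v : Fin (n + 1) → F) :
    formWedge φ k v = ∑ i : Fin (n + 1), (-1) ^ (i : ℕ) • φ (v i) • k (i.removeNth v) := by
  rw [formWedge, AlternatingMap.alternatizeUncurryFin_apply]
  rfl

/-- Contraction is an antiderivation, so the only other term is `φ ∧ ι_x k`. Phrasing `ι_x k = 0` by
tuples also covers `n = 0`. -/
theorem contraction_formWedge (φ : F →ₗ[R] R) {n : ℕ} (k : F [⋀^Fin n]→ₗ[R] M) (x : F)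
    (hk : ∀ (v : Fin n → F) (i : Fin n), v i = x → k v = 0) :
    contraction M x n (formWedge φ k) = φ x • k := by
  ext v
  rw [contraction_apply, formWedge_apply, Fin.sum_univ_succ, Finset.sum_eq_zero, add_zero]
  · simp [Matrix.vecCons]
  · intro i _
    obtain ⟨m, rfl⟩ : ∃ m, n = m + 1 := ⟨n - 1, by have := i.pos; omega⟩
    rw [hk _ 0 (by simp [Fin.removeNth, Matrix.vecCons]), smul_zero, smul_zero]

theorem apply_eq_zero_of_contraction_eq_zero {x : F} {n : ℕ} {k : F [⋀^Fin (n + 1)]→ₗ[R] M}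
    (hk : contraction M x n k = 0) (v : Fin (n + 1) → F) (i : Fin (n + 1)) (hv : v i = x) :
    k v = 0 := by
  have h := k.map_insertNth i x (i.removeNth v)
  rw [← contraction_apply, hk, AlternatingMap.zero_apply, smul_zero] at h
  rwa [← hv, Fin.insertNth_self_removeNth] at h

/-- Wedging with `φ` is a homotopy for multiplication by `φ x`. For `F = R^d` the values `φ x` are
exactly the elements of the ideal `(x)`, which therefore kills Koszul homology. -/
theorem exists_contraction_eq_smul (φ : F →ₗ[R] R) (x : F) (n : ℕ)
    (k : F [⋀^Fin (n + 1)]→ₗ[R] M) (hk : contraction M x n k = 0) :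
    ∃ w, contraction M x (n + 1) w = φ x • k :=
  ⟨formWedge φ k, contraction_formWedge φ k x (apply_eq_zero_of_contraction_eq_zero hk)⟩

theorem eq_zero_of_restrict_eq_zero {n : ℕ} (f : (R × F) [⋀^Fin (n + 1)]→ₗ[R] M)
    (h : f.compLinearMap (LinearMap.inr R R F) = 0)
    (h' : (contraction M (1, 0) n f).compLinearMap (LinearMap.inr R R F) = 0) : f = 0 := by
  induction n with
  | zero =>
    ext v
    have hv : v = Matrix.vecCons ((v 0).1 • ((1 : R), (0 : F)) + LinearMap.inr R R F (v 0).2)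
        (fun i => LinearMap.inr R R F (Fin.elim0 i)) := by
      funext i
      obtain rfl : i = 0 := Subsingleton.elim (α := Fin 1) i 0
      simp
    rw [hv, ← contraction_apply, contraction_add, contraction_smul]
    have h1 := DFunLike.congr_fun h' Fin.elim0
    have h2 := DFunLike.congr_fun (congrArg (contraction M (v 0).2 0) h) Fin.elim0
    rw [contraction_compLinearMap] at h2
    simp only [AlternatingMap.compLinearMap_apply, AlternatingMap.zero_apply, map_zero] at h1 h2
    rw [AlternatingMap.add_apply, AlternatingMap.smul_apply, h1, h2]
    simp
  | succ n ih =>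
    have key : ∀ w : R × F, contraction M w (n + 1) f = 0 := by
      intro w
      have hw : w = w.1 • ((1 : R), (0 : F)) + LinearMap.inr R R F w.2 := by
        simp
      rw [hw, contraction_add, contraction_smul]
      have h1 : contraction M (1, 0) (n + 1) f = 0 := by
        refine ih _ h' ?_
        rw [contraction_contraction]
        rfl
      rw [h1, smul_zero, zero_add]
      refine ih _ ?_ ?_
      · rw [← contraction_compLinearMap, h, map_zero]
      · rw [contraction_comm, h1, map_zero, neg_zero]
        rfl
    ext v
    rw [← Matrix.cons_head_tail v, ← contraction_apply, key]
    rfl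

variable (R F M) in
/-- The splitting of alternating maps on `R × F` according to whether they involve the first
basis vector. -/
def alternatingSplit (n : ℕ) : ((R × F) [⋀^Fin (n + 1)]→ₗ[R] M) →ₗ[R]
    (F [⋀^Fin (n + 1)]→ₗ[R] M) × (F [⋀^Fin n]→ₗ[R] M) where
  toFun f := (f.compLinearMap (LinearMap.inr R R F),
    (contraction M (1, 0) n f).compLinearMap (LinearMap.inr R R F))
  map_add' _ _ := rfl
  map_smul' _ _ := rfl

theorem alternatingSplit_apply (n : ℕ) (f : (R × F) [⋀^Fin (n + 1)]→ₗ[R] M) :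
    alternatingSplit R F M n f = (f.compLinearMap (LinearMap.inr R R F),
      (contraction M (1, 0) n f).compLinearMap (LinearMap.inr R R F)) := rfl

theorem alternatingSplit_bijective (n : ℕ) :
    Function.Bijective (alternatingSplit R F M n) := by
  constructor
  · rw [injective_iff_map_eq_zero]
    intro f hf
    exact eq_zero_of_restrict_eq_zero f (congrArg Prod.fst hf) (congrArg Prod.snd hf)
  · rintro ⟨g, h⟩
    have hsnd : LinearMap.snd R R F ∘ₗ LinearMap.inr R R F = LinearMap.id := by ext; rfl
    have hh : contraction M ((1 : R), (0 : F)) n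
        (formWedge (LinearMap.fst R R F) (h.compLinearMap (LinearMap.snd R R F))) =
          h.compLinearMap (LinearMap.snd R R F) := by
      rw [contraction_formWedge]
      · simp
      · intro v i hv
        exact h.map_coord_zero i (by simp [hv])
    have hg : contraction M ((1 : R), (0 : F)) n (g.compLinearMap (LinearMap.snd R R F)) = 0 := by
      ext v
      exact g.map_coord_zero 0 rfl
    have hr : (formWedge (LinearMap.fst R R F)
        (h.compLinearMap (LinearMap.snd R R F))).compLinearMap (LinearMap.inr R R F) = 0 := by
      ext v
      simp [formWedge_apply]
    -- The preimage is `g + e₀* ∧ h`, with `g` and `h` pulled back along the projection to `F`.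
    refine ⟨g.compLinearMap (LinearMap.snd R R F) +
      formWedge (LinearMap.fst R R F) (h.compLinearMap (LinearMap.snd R R F)), ?_⟩
    refine Prod.ext ?_ ?_
    · change AlternatingMap.compLinearMap _ _ = g
      rw [AlternatingMap.add_compLinearMap, hr, add_zero, AlternatingMap.compLinearMap_assoc, hsnd,
        AlternatingMap.compLinearMap_id]
    · change AlternatingMap.compLinearMap _ _ = h
      rw [map_add, hg, hh, zero_add, AlternatingMap.compLinearMap_assoc, hsnd,
        AlternatingMap.compLinearMap_id]

theorem contraction_mk (a : R) (x : F) (n : ℕ) (f : (R × F) [⋀^Fin (n + 1)]→ₗ[R] M) :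
    contraction M (a, x) n f =
      contraction M (LinearMap.inr R R F x) n f + a • contraction M (1, 0) n f := by
  rw [← contraction_smul, ← contraction_add]
  simp

/-- The sign in `coneD` comes from moving contraction by `x` past contraction by the new basis
vector. -/
theorem alternatingSplit_contraction (a : R) (x : F) (n : ℕ)
    (f : (R × F) [⋀^Fin (n + 2)]→ₗ[R] M) :
    alternatingSplit R F M n (contraction M (a, x) (n + 1) f) =
      coneD a (contraction M x (n + 1)) (contraction M x n) (alternatingSplit R F M (n + 1) f) := by
  rw [coneD_apply]
  refine Prod.ext ?_ ?_
  · simp only [alternatingSplit_apply]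
    rw [contraction_mk, contraction_compLinearMap]
    rfl
  · simp only [alternatingSplit_apply]
    rw [contraction_mk a x, map_add, map_smul, contraction_contraction, smul_zero, add_zero,
      contraction_comm, contraction_compLinearMap]
    rfl

variable (R F M) in
/-- Restriction of `0`-forms from `R × F` to `F` is an isomorphism. -/
def alternatingSplitZero : ((R × F) [⋀^Fin 0]→ₗ[R] M) ≃ₗ[R]
    (F [⋀^Fin 0]→ₗ[R] M) × PUnit.{1} where
  toFun f := (f.compLinearMap (LinearMap.inr R R F), 0)
  invFun p := p.1.compLinearMap (LinearMap.snd R R F)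
  map_add' _ _ := rfl
  map_smul' _ _ := rfl
  left_inv f := by
    ext v
    exact congrArg f (Subsingleton.elim _ _)
  right_inv p := by
    refine Prod.ext ?_ (Subsingleton.elim _ _)
    ext v
    exact congrArg p.1 (Subsingleton.elim _ _)

theorem alternatingSplitZero_apply (f : (R × F) [⋀^Fin 0]→ₗ[R] M) :
    alternatingSplitZero R F M f = (f.compLinearMap (LinearMap.inr R R F), 0) := rfl

theorem alternatingSplitZero_contraction (a : R) (x : F) (f : (R × F) [⋀^Fin 1]→ₗ[R] M) :
    alternatingSplitZero R F M (contraction M (a, x) 0 f) =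
      coneD a (contraction M x 0) (0 : _ →ₗ[R] PUnit.{1}) (alternatingSplit R F M 0 f) := by
  rw [coneD_apply]
  refine Prod.ext ?_ (Subsingleton.elim _ _)
  simp only [alternatingSplitZero_apply, alternatingSplit_apply]
  rw [contraction_mk, contraction_compLinearMap]
  rfl

variable (R M) in
/-- The length of the homology in degree `n + 1` of the complex of alternating maps on `F` with
contraction by `x`. -/
noncomputable def contractionLength (x : F) (n : ℕ) : ℕ∞ :=
  homologyLength (R := R) (contraction M x (n + 1)) (contraction M x n)

/-- Precomposition of alternating maps with a linear equivalence. -/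
def alternatingCongr (e : F ≃ₗ[R] F') (n : ℕ) :
    (F [⋀^Fin n]→ₗ[R] M) ≃ₗ[R] (F' [⋀^Fin n]→ₗ[R] M) where
  toFun f := f.compLinearMap e.symm.toLinearMap
  invFun f := f.compLinearMap e.toLinearMap
  map_add' _ _ := rfl
  map_smul' _ _ := rfl
  left_inv f := by ext v; simp
  right_inv f := by ext v; simp

theorem contractionLength_congr (e : F ≃ₗ[R] F') (x : F) (n : ℕ) :
    contractionLength R M (e x) n = contractionLength R M x n := by
  have h : ∀ (m : ℕ) (f : F [⋀^Fin (m + 1)]→ₗ[R] M),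
      alternatingCongr e m (contraction M x m f) =
        contraction M (e x) m (alternatingCongr e (m + 1) f) := fun m f => by
    change _ = contraction M (e x) m (f.compLinearMap e.symm.toLinearMap)
    rw [contraction_compLinearMap, LinearEquiv.coe_coe, e.symm_apply_apply]
    rfl
  exact (homologyLength_congr (alternatingCongr e _) (alternatingCongr e _) (alternatingCongr e _)
    (h _) (h _)).symm

theorem contractionLength_prod_succ (a : R) (x : F) (n : ℕ) :
    contractionLength R M (a, x) (n + 1) =
      homologyLength (coneD a (contraction M x (n + 2)) (contraction M x (n + 1)))
        (coneD a (contraction M x (n + 1)) (contraction M x n)) :=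
  homologyLength_congr (.ofBijective _ (alternatingSplit_bijective (n + 2)))
    (.ofBijective _ (alternatingSplit_bijective (n + 1)))
    (.ofBijective _ (alternatingSplit_bijective n))
    (alternatingSplit_contraction a x (n + 1)) (alternatingSplit_contraction a x n)

/-- In degree 1 the cone ends in the zero module, which stands for degree `-1` of the complex of
`x`. -/
theorem contractionLength_prod_zero (a : R) (x : F) :
    contractionLength R M (a, x) 0 =
      homologyLength (coneD a (contraction M x 1) (contraction M x 0))
        (coneD a (contraction M x 0) (0 : _ →ₗ[R] PUnit.{1})) :=
  homologyLength_congr (.ofBijective _ (alternatingSplit_bijective 1))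
    (.ofBijective _ (alternatingSplit_bijective 0)) (alternatingSplitZero R F M)
    (alternatingSplit_contraction a x 0) (alternatingSplitZero_contraction a x)

theorem contractionLength_prod_le (a : R) (x : F) (n : ℕ) :
    contractionLength R M (a, x) (n + 1) ≤
      contractionLength R M x (n + 1) + contractionLength R M x n := by
  rw [contractionLength_prod_succ]
  exact homologyLength_coneD_le a _ _ _

theorem contractionLength_prod_eq (φ : F →ₗ[R] R) (x : F) (n : ℕ) :
    contractionLength R M (φ x, x) (n + 1) =
      contractionLength R M x (n + 1) + contractionLength R M x n := by
  rw [contractionLength_prod_succ]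
  exact homologyLength_coneD_eq _ _ _ _
    (exists_contraction_eq_smul φ x _) (exists_contraction_eq_smul φ x _)

theorem contractionLength_prod_mul_le (a b : R) (x : F) (n : ℕ) :
    contractionLength R M (a * b, x) n ≤
      contractionLength R M (a, x) n + contractionLength R M (b, x) n := by
  cases n with
  | zero =>
    simp only [contractionLength_prod_zero]
    exact homologyLength_coneD_mul_le _ _ _ _ _
  | succ n =>
    simp only [contractionLength_prod_succ]
    exact homologyLength_coneD_mul_le _ _ _ _ _

theorem contractionLength_prod_pow_le (a : R) (x : F) (n t : ℕ) :
    contractionLength R M (a ^ (t + 1), x) n ≤ (t + 1 : ℕ) * contractionLength R M (a, x) n := by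
  induction t with
  | zero => simp
  | succ t ih =>
    rw [pow_succ]
    refine (contractionLength_prod_mul_le _ _ _ _).trans ((add_le_add_left ih _).trans ?_)
    rw [Nat.cast_succ (t + 1), add_mul, one_mul]

end Contraction

/-! ### Comparing sums of homology lengths. -/

section TailLength

variable {R : Type*} [CommRing R] {F : Type*} [AddCommGroup F] [Module R F]
  {F' : Type*} [AddCommGroup F'] [Module R F'] {M : Type*} [AddCommGroup M] [Module R M]

variable (R M) in
/-- The sum of `N` consecutive lengths of homology modules, starting in degree `i + 1`. -/
noncomputable def tailLength (x : F) (i N : ℕ) : ℕ∞ :=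
  ∑ j ∈ Finset.range N, contractionLength R M x (i + j)

theorem tailLength_congr (e : F ≃ₗ[R] F') (x : F) (i N : ℕ) :
    tailLength R M (e x) i N = tailLength R M x i N :=
  Finset.sum_congr rfl fun _ _ => contractionLength_congr e x _

theorem tailLength_prod_le (a : R) (x : F) (i N : ℕ) :
    tailLength R M (a, x) (i + 1) N ≤ 2 * tailLength R M x i (N + 1) := by
  have h : tailLength R M (a, x) (i + 1) N ≤
      ∑ j ∈ Finset.range N, contractionLength R M x (i + (j + 1)) +
        ∑ j ∈ Finset.range N, contractionLength R M x (i + j) := by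
    rw [← Finset.sum_add_distrib]
    refine Finset.sum_le_sum fun j _ => ?_
    rw [show i + 1 + j = i + j + 1 by ring]
    exact contractionLength_prod_le a x (i + j)
  refine h.trans ?_
  rw [two_mul]
  refine add_le_add ?_ ?_
  · rw [tailLength, Finset.sum_range_succ']
    exact le_self_add
  · rw [tailLength, Finset.sum_range_succ]
    exact le_self_add

theorem le_tailLength_prod (φ : F →ₗ[R] R) (x : F) (i N : ℕ) :
    tailLength R M x i N ≤ tailLength R M (φ x, x) (i + 1) N := by
  refine Finset.sum_le_sum fun j _ => ?_
  rw [show i + 1 + j = i + j + 1 by ring, contractionLength_prod_eq]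
  exact le_add_self

variable (R F) in
/-- Splitting off the first coordinate. -/
def consProdEquiv (m : ℕ) : ((Fin (m + 1) → R) × F) ≃ₗ[R] R × ((Fin m → R) × F) :=
  ((Fin.consLinearEquiv R fun _ : Fin (m + 1) => R).symm.prodCongr (LinearEquiv.refl R F)).trans
    (LinearEquiv.prodAssoc R R (Fin m → R) F)

theorem consProdEquiv_apply (m : ℕ) (y : Fin (m + 1) → R) (x : F) :
    consProdEquiv R F m (y, x) = (y 0, (Fin.tail y, x)) := rfl

/-- Each adjoined element doubles the bound and widens the window of degrees by one. -/
theorem tailLength_prod_family_le {m : ℕ} (y : Fin m → R) (x : F) (i N : ℕ) :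
    tailLength R M (y, x) (i + m) N ≤ 2 ^ m * tailLength R M x i (N + m) := by
  induction m generalizing N with
  | zero =>
    rw [← tailLength_congr (LinearEquiv.uniqueProd (R := R) (M := F) (M₂ := Fin 0 → R))]
    simp
  | succ m ih =>
    rw [← tailLength_congr (consProdEquiv R F m), consProdEquiv_apply, ← add_assoc]
    refine (tailLength_prod_le _ _ _ _).trans ?_
    rw [pow_succ', mul_assoc, ← add_assoc, add_right_comm]
    gcongr
    exact ih _ _

/-- At each step the summand `h_{j-1}` in the split cone formula survives, shifting the start by
one. The form `φ` on `F` extends to the enlarged module by projection. -/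
theorem le_tailLength_prod_family {m : ℕ} (y : Fin m → R) (x : F)
    (h : ∀ k, ∃ φ : F →ₗ[R] R, φ x = y k) (i N : ℕ) :
    tailLength R M x i N ≤ tailLength R M (y, x) (i + m) N := by
  induction m with
  | zero =>
    rw [← tailLength_congr (LinearEquiv.uniqueProd (R := R) (M := F) (M₂ := Fin 0 → R)) (y, x)]
    simp
  | succ m ih =>
    rw [← tailLength_congr (consProdEquiv R F m), consProdEquiv_apply, ← add_assoc]
    obtain ⟨φ, hφ⟩ := h 0
    refine (ih (Fin.tail y) fun k => h k.succ).trans ?_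
    rw [← hφ]
    have key := le_tailLength_prod (M := M) (φ ∘ₗ LinearMap.snd R (Fin m → R) F) (Fin.tail y, x)
      (i + m) N
    rwa [LinearMap.comp_apply, LinearMap.snd_apply] at key

theorem tailLength_le_of_mem_span {d : ℕ} (x y : Fin d → R)
    (h : ∀ k, y k ∈ Ideal.span (Set.range x)) (i N : ℕ) :
    tailLength R M x i N ≤ 2 ^ d * tailLength R M y i (N + d) := by
  refine (le_tailLength_prod_family y x (fun k => ?_) i N).trans ?_
  · obtain ⟨c, hc⟩ := (Submodule.mem_span_range_iff_exists_fun R).1 (h k)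
    refine ⟨∑ j, c j • LinearMap.proj j, ?_⟩
    rw [← hc]
    simp
  · rw [← tailLength_congr (LinearEquiv.prodComm R (Fin d → R) (Fin d → R))]
    exact tailLength_prod_family_le x y i N

variable (R) in
/-- Splitting off the coordinate `k`. -/
def splitAtEquiv {ι : Type*} [DecidableEq ι] (k : ι) : (ι → R) ≃ₗ[R] R × ({j // j ≠ k} → R) where
  __ := Equiv.funSplitAt k R
  map_add' _ _ := rfl
  map_smul' _ _ := rfl

theorem splitAtEquiv_apply {ι : Type*} [DecidableEq ι] (k : ι) (x : ι → R) :
    splitAtEquiv R k x = (x k, fun j : {j // j ≠ k} => x j) := rfl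

/-- Invariance under linear equivalences moves coordinate `k` to the front, where the cone bound for
powers applies. -/
theorem contractionLength_update_pow_le {ι : Type*} [DecidableEq ι] (x : ι → R) (k : ι)
    (t n : ℕ) :
    contractionLength R M (Function.update x k (x k ^ (t + 1))) n ≤
      (t + 1 : ℕ) * contractionLength R M x n := by
  have h : ∀ a : R, splitAtEquiv R k (Function.update x k a) =
      (a, fun j : {j // j ≠ k} => x j) := fun a => by
    refine Prod.ext (by simp [splitAtEquiv_apply]) ?_
    funext j
    simp [splitAtEquiv_apply, j.2]
  have hx := h (x k)
  rw [Function.update_eq_self] at hx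
  rw [← contractionLength_congr (splitAtEquiv R k) (Function.update _ _ _),
    ← contractionLength_congr (splitAtEquiv R k) x, h, hx]
  exact contractionLength_prod_pow_le _ _ _ _

theorem contractionLength_pow_le {ι : Type*} [Fintype ι] (x : ι → R) (t n : ℕ) :
    contractionLength R M (fun j => x j ^ (t + 1)) n ≤
      (t + 1 : ℕ) ^ Fintype.card ι * contractionLength R M x n := by
  classical
  -- Entries are raised to the power one at a time, each costing a factor `t + 1`.
  have key : ∀ s : Finset ι,
      contractionLength R M (fun j => if j ∈ s then x j ^ (t + 1) else x j) n ≤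
        (t + 1 : ℕ) ^ s.card * contractionLength R M x n := by
    intro s
    induction s using Finset.induction_on with
    | empty => simp
    | insert k s hk ih =>
      have hu : (fun j => if j ∈ insert k s then x j ^ (t + 1) else x j) =
          Function.update (fun j => if j ∈ s then x j ^ (t + 1) else x j) k
            ((fun j => if j ∈ s then x j ^ (t + 1) else x j) k ^ (t + 1)) := by
        funext j
        by_cases hj : j = k
        · subst hj
          simp [hk]
        · simp [hj]
      rw [hu, Finset.card_insert_of_notMem hk, pow_succ' _ s.card, mul_assoc]
      refine (contractionLength_update_pow_le _ k t n).trans ?_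
      gcongr
  simpa using key Finset.univ

theorem contractionLength_eq_zero {d : ℕ} (x : Fin d → R) {n : ℕ} (h : d ≤ n) :
    contractionLength R M x n = 0 := by
  have hsub : ∀ f : (Fin d → R) [⋀^Fin (n + 1)]→ₗ[R] M, f = 0 := fun f => by
    refine Module.Basis.ext_alternating (Pi.basisFun R (Fin d)) fun v hv => ?_
    have := Fintype.card_le_of_injective v hv
    simp at this
    omega
  have : Subsingleton (LinearMap.ker (contraction M x n)) :=
    ⟨fun a b => Subtype.ext ((hsub a.1).trans (hsub b.1).symm)⟩
  exact Module.length_eq_zero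

end TailLength

/-! ### Transfer to Koszul homology and the asymptotic condition. -/

section Koszul

variable {R : Type u} [CommRing R] {d : ℕ} (x : Fin d → R) (M : Type v) [AddCommGroup M]
  [Module R M]

theorem koszulLength_succ (n : ℕ) :
    koszulLength x M (n + 1) = contractionLength R M x n := by
  let K := koszulComplex x M
  let S : ShortComplex (ModuleCat.{max u v} R) :=
    ShortComplex.mk (ModuleCat.ofHom (koszulD x M (n + 1))) (ModuleCat.ofHom (koszulD x M n))
      (by rw [← ModuleCat.ofHom_comp, koszulD_comp_koszulD]; rfl)
  have hd : ∀ m, K.d (m + 1) m = ModuleCat.ofHom (koszulD x M m) := fun m =>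
    ChainComplex.of_d (V := ModuleCat.{max u v} R)
      (fun i => ModuleCat.of R ((Fin d → R) [⋀^Fin i]→ₗ[R] M))
      (fun i => ModuleCat.ofHom (koszulD x M i)) m
  have e : K.sc (n + 1) ≅ S :=
    K.isoSc' (n + 2) (n + 1) n (by simp) (by simp) ≪≫
      ShortComplex.isoMk (Iso.refl _) (Iso.refl _) (Iso.refl _)
        ((Category.id_comp _).trans ((hd _).symm.trans (Category.comp_id _).symm))
        ((Category.id_comp _).trans ((hd _).symm.trans (Category.comp_id _).symm))
  have e' : K.homology (n + 1) ≅ S.moduleCatLeftHomologyData.H :=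
    ShortComplex.homologyMapIso e ≪≫ S.moduleCatHomologyIso
  rw [koszulLength, e'.toLinearEquiv.length_eq]
  have hr : LinearMap.range S.moduleCatToCycles =
      (LinearMap.range (contraction M x (n + 1))).submoduleOf
        (LinearMap.ker (contraction M x n)) := by
    ext z
    constructor
    · rintro ⟨w, rfl⟩
      exact ⟨w, rfl⟩
    · rintro ⟨w, hw⟩
      exact ⟨w, Subtype.ext hw⟩
  exact (Submodule.quotEquivOfEq _ _ hr).length_eq

theorem koszulLength_eq_zero {j : ℕ} (h : d < j) : koszulLength x M j = 0 := by
  obtain ⟨n, rfl⟩ : ∃ n, j = n + 1 := ⟨j - 1, by omega⟩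
  rw [koszulLength_succ]
  exact contractionLength_eq_zero x (by omega)

theorem koszulSigma_succ (i : ℕ) {N : ℕ} (h : d ≤ N) :
    koszulSigma x M (i + 1) = tailLength R M x i N := by
  have h1 : tailLength R M x i N = ∑ j ∈ Finset.Ico (i + 1) (i + 1 + N), koszulLength x M j := by
    rw [Finset.sum_Ico_eq_sum_range, Nat.add_sub_cancel_left, tailLength]
    refine Finset.sum_congr rfl fun j _ => ?_
    rw [← koszulLength_succ, add_right_comm]
  rw [h1, koszulSigma]
  refine Finset.sum_subset (fun j hj => ?_) fun j hj hj' => koszulLength_eq_zero x M ?_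
  · simp only [Finset.mem_Icc, Finset.mem_Ico] at *
    omega
  · simp only [Finset.mem_Icc, Finset.mem_Ico] at *
    omega

theorem koszulLength_le_koszulSigma (i : ℕ) : koszulLength x M i ≤ koszulSigma x M i := by
  by_cases h : i ≤ d
  · exact Finset.single_le_sum (f := koszulLength x M) (fun _ _ => zero_le)
      (Finset.mem_Icc.2 ⟨le_rfl, h⟩)
  · rw [koszulLength_eq_zero x M (not_le.1 h)]
    exact zero_le

variable {x} in
theorem exists_koszulSigma_le {y : Fin d → R}
    (h : ∀ k, x k ∈ (Ideal.span (Set.range y)).radical) :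
    ∃ C : ℕ, 0 < C ∧ ∀ (M : Type v) [AddCommGroup M] [Module R M] (i : ℕ), 1 ≤ i →
      koszulSigma y M i ≤ C * koszulSigma x M i := by
  choose n hn using h
  let t := ∑ k, n k
  -- The factor `2 ^ d` comes from adjoining `y`, and `(t + 1) ^ d` from taking powers of `x`.
  refine ⟨2 ^ d * (t + 1) ^ d, by positivity, fun M _ _ i hi => ?_⟩
  obtain ⟨i, rfl⟩ : ∃ m, i = m + 1 := ⟨i - 1, by omega⟩
  -- The window for `x` has length `d + d` to absorb the widening; its terms above degree `d`
  -- vanish.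
  rw [koszulSigma_succ y M i le_rfl, koszulSigma_succ x M i (Nat.le_add_left d d)]
  have hmem : ∀ k, x k ^ (t + 1) ∈ Ideal.span (Set.range y) := fun k =>
    Ideal.pow_mem_of_pow_mem _ (hn k)
      ((Finset.single_le_sum (fun _ _ => Nat.zero_le _) (Finset.mem_univ k)).trans (Nat.le_succ t))
  refine (tailLength_le_of_mem_span y _ hmem i d).trans ?_
  rw [Nat.cast_mul, Nat.cast_pow, Nat.cast_pow, mul_assoc, Nat.cast_ofNat]
  gcongr
  rw [tailLength, tailLength, Finset.mul_sum]
  refine Finset.sum_le_sum fun j _ => ?_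
  simpa using contractionLength_pow_le (M := M) x t (i + j)

variable {x M} in
theorem KoszulLittleO.of_koszulSigma_le [IsLocalRing R] {e : ℕ} {y : Fin e → R} {C : ℕ}
    (hC : ∀ (M : Type v) [AddCommGroup M] [Module R M] (i : ℕ), 1 ≤ i →
      koszulSigma y M i ≤ C * koszulSigma x M i)
    {M : ℕ → Type v} [∀ n, AddCommGroup (M n)] [∀ n, Module R (M n)] (h : KoszulLittleO x M) :
    KoszulLittleO y M := by
  intro i hi ε hε
  -- Since `i ≥ 1`, `σ_i` has at most `d` terms, so `C * d` is the loss; the added ones keep `D`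
  -- positive.
  let D : ℝ≥0 := (C + 1) * (d + 1)
  have hD : 0 < D := by positivity
  have hev : ∀ᶠ n in atTop, ∀ j ∈ Finset.Icc i d,
      (koszulLength x (M n) j : ℝ≥0∞) ≤ ((ε / D : ℝ≥0) : ℝ≥0∞) * minGenerators R (M n) :=
    (Filter.eventually_all_finset _).2 fun j hj =>
      h j (hi.trans (Finset.mem_Icc.1 hj).1) _ (div_pos hε hD)
  filter_upwards [hev] with n hn
  have h1 : (koszulLength y (M n) i : ℝ≥0∞) ≤ (C : ℝ≥0∞) * (koszulSigma x (M n) i : ℝ≥0∞) := by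
    have := (koszulLength_le_koszulSigma y (M n) i).trans (hC (M n) i hi)
    simpa using ENat.toENNReal_le.2 this
  have h2 : (koszulSigma x (M n) i : ℝ≥0∞) ≤
      (d : ℝ≥0∞) * (((ε / D : ℝ≥0) : ℝ≥0∞) * minGenerators R (M n)) := by
    have hs : (koszulSigma x (M n) i : ℝ≥0∞) =
        ∑ j ∈ Finset.Icc i d, (koszulLength x (M n) j : ℝ≥0∞) :=
      map_sum ENat.toENNRealRingHom _ _
    rw [hs]
    refine (Finset.sum_le_card_nsmul _ _ _ hn).trans ?_
    rw [nsmul_eq_mul]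
    gcongr
    simp only [Nat.card_Icc]
    omega
  refine h1.trans ((mul_le_mul_right h2 _).trans ?_)
  rw [← mul_assoc, ← mul_assoc]
  gcongr
  have h3 : (C : ℝ≥0) * d * (ε / D) ≤ ε := by
    rw [mul_div_left_comm]
    refine mul_le_of_le_one_right (zero_le) (div_le_one_of_le₀ ?_ (zero_le))
    exact mul_le_mul (by simp) (by simp) (zero_le) (zero_le)
  exact_mod_cast h3

end Koszul

theorem IsSystemOfParameters.mem_radical {R : Type u} [CommRing R] [IsLocalRing R] {d e : ℕ}
    {x : Fin d → R} {y : Fin e → R} (hx : IsSystemOfParameters x) (hy : IsSystemOfParameters y)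
    (k : Fin d) : x k ∈ (Ideal.span (Set.range y)).radical := by
  rw [hy.2, ← hx.2]
  exact Ideal.le_radical (Ideal.subset_span ⟨k, rfl⟩)

theorem KoszulLittleO.of_isSystemOfParameters {R : Type u} [CommRing R] [IsLocalRing R] {d : ℕ}
    {x y : Fin d → R} (hx : IsSystemOfParameters x) (hy : IsSystemOfParameters y)
    {M : ℕ → Type v} [∀ n, AddCommGroup (M n)] [∀ n, Module R (M n)] (h : KoszulLittleO x M) :
    KoszulLittleO y M :=
  have ⟨_, _, hC⟩ := exists_koszulSigma_le.{u, v} (hx.mem_radical hy)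
  h.of_koszulSigma_le hC

theorem theorem4p3 {R : Type u} [CommRing R] [IsNoetherianRing R] [IsLocalRing R]
    {d : ℕ} (x y : Fin d → R) (hx : IsSystemOfParameters x) (hy : IsSystemOfParameters y) :
    (∃ C C' : ℕ, 0 < C ∧ 0 < C' ∧
      ∀ (M : Type v) [AddCommGroup M] [Module R M] (i : ℕ), 1 ≤ i →
        koszulSigma x M i ≤ C * koszulSigma y M i ∧
        koszulSigma y M i ≤ C' * koszulSigma x M i) ∧
    (∀ (M : ℕ → Type v) [∀ n, AddCommGroup (M n)] [∀ n, Module R (M n)],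
      (∀ n, Module.Finite R (M n)) →
        (KoszulLittleO x M ↔ KoszulLittleO y M)) ∧
    (∀ (M : ℕ → Type v) [∀ n, AddCommGroup (M n)] [∀ n, Module R (M n)],
      (∀ n, Module.Finite R (M n)) → (∀ n, Nontrivial (M n)) →
        (IsLimCohenMacaulay R M ↔ KoszulLittleO x M)) := by
  refine ⟨?_, fun M _ _ _ => ⟨.of_isSystemOfParameters hx hy, .of_isSystemOfParameters hy hx⟩,
    fun M _ _ hfin hnt => ⟨?_, fun h => ⟨fun n => ⟨hfin n, hnt n⟩, d, x, hx, h⟩⟩⟩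
  · obtain ⟨C', hC', h'⟩ := exists_koszulSigma_le.{u, v} (hx.mem_radical hy)
    obtain ⟨C, hC, h⟩ := exists_koszulSigma_le.{u, v} (hy.mem_radical hx)
    exact ⟨C, C', hC, hC', fun M _ _ i hi => ⟨h M i hi, h' M i hi⟩⟩
  · rintro ⟨_, e, z, hz, h⟩
    -- Both lengths equal the Krull dimension.
    obtain rfl : e = d := by exact_mod_cast hz.1.symm.trans hx.1
    exact h.of_isSystemOfParameters hz hx
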